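/- All rings are commutative with $1$. Let $R$ be a ring and $S\subseteq R$ a multiplicative subset ($1\in S$ and $S$ is closed under products). An $R$-module $T$ is *uniformly $S$-torsion* if $sT=0$ for some $s\in S$. A sequence $M\xrightarrow{f}N\xrightarrow{g}L$ of $R$-modules is *$S$-exact* (at $N$) if there is $s\in S$ with $s\operatorname{Ker}(g)\subseteq\operatorname{Im}(f)$ and $s\operatorname{Im}(f)\subseteq\operatorname{Ker}(g)$; a longer sequence is $S$-exact if it is so at each inner term. An $R$-module $F$ is *$S$-flat* if for every $S$-exact sequence $0\to A\to B\to C\to 0$ the induced sequence $0\to A\otimes_RF\to B\otimes_RF\to C\otimes_RF\to 0$ is $S$-exact. The *$S$-flat dimension* $S\text{-}fd_R(M)$ of an $R$-module $M$ is the least $n\ge 0$ such that there is an $S$-exact sequence $0\to F_n\to\cdots\to F_1\to F_0\to M\to 0$ with all $F_i$ $S$-flat, and $\infty$ if there is no such $n$. The *$S$-weak global dimension* is $S\text{-w.gl.dim}(R)=\sup\{S\text{-}fd_R(M)\mid M\text{ an }R\text{-module}\}$. **Proposition.** Let $R$ be a ring, $S$ a multiplicative subset of $R$, and let $a\in R$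 be neither a zero-divisor nor a unit. Write $\overline R=R/aR$ and $\overline S=\{s+aR\mid s\in S\}\subseteq\overline R$. 1. Let $M$ be an $\overline R$-module that is not uniformly $\overline S$-torsion (in particular $M\neq 0$). If $\overline S\text{-}fd_{\overline R}(M)<\infty$, then $$S\text{-}fd_R(M)=\overline S\text{-}fd_{\overline R}(M)+1 .$$ 2. Suppose $0\notin\overline S$, that is, $S\cap aR=\emptyset$. If $\overline S\text{-w.gl.dim}(\overline R)<\infty$, then $$S\text{-w.gl.dim}(R)\ \ge\ \overline S\text{-w.gl.dim}(\overline R)+1 .$$ -/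

import Mathlib

open scoped TensorProduct

universe u

/-- `T` is uniformly `S`-torsion: a single element of `S` annihilates `T`. -/
def IsUniformlySTorsion {R : Type u} [CommRing R] (S : Submonoid R)
    (T : Type u) [AddCommGroup T] [Module R T] : Prop :=
  ∃ s ∈ S, ∀ t : T, s • t = 0

/-- `M --f--> N --g--> L` is `S`-exact at `N`: for some `s ∈ S`,
`s Ker g ⊆ Im f` and `s Im f ⊆ Ker g`. -/
def SExact {R : Type u} [CommRing R] (S : Submonoid R)
    {M N L : Type u} [AddCommGroup M] [AddCommGroup N] [AddCommGroup L]
    [Module R M] [Module R N] [Module R L] (f : M →ₗ[R] N) (g : N →ₗ[R] L) : Prop :=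
  ∃ s ∈ S, (∀ y ∈ LinearMap.ker g, s • y ∈ LinearMap.range f) ∧
    (∀ y ∈ LinearMap.range f, s • y ∈ LinearMap.ker g)

/-- `0 → A --f--> B --g--> C → 0` is `S`-exact, i.e. `S`-exact at each of `A`, `B` and `C`. -/
structure ShortSExact {R : Type u} [CommRing R] (S : Submonoid R)
    {A B C : Type u} [AddCommGroup A] [AddCommGroup B] [AddCommGroup C]
    [Module R A] [Module R B] [Module R C] (f : A →ₗ[R] B) (g : B →ₗ[R] C) : Prop where
  left : SExact S (0 : PUnit.{u+1} →ₗ[R] A) f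
  middle : SExact S f g
  right : SExact S g (0 : C →ₗ[R] PUnit.{u+1})

/-- `F` is `S`-flat: `- ⊗ F` preserves short `S`-exact sequences. -/
def IsSFlat {R : Type u} [CommRing R] (S : Submonoid R)
    (F : Type u) [AddCommGroup F] [Module R F] : Prop :=
  ∀ (A B C : Type u) [AddCommGroup A] [AddCommGroup B] [AddCommGroup C]
    [Module R A] [Module R B] [Module R C] (f : A →ₗ[R] B) (g : B →ₗ[R] C),
    ShortSExact S f g → ShortSExact S (f.rTensor F) (g.rTensor F)

/-- An `S`-flat `S`-resolution `0 → F_n → ⋯ → F_1 → F_0 → M → 0` of length `n`: an `S`-exact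
sequence with each `F_i` `S`-flat. The sequence is indexed by all of `ℕ`, with `F_i = 0` for
`i > n`, so that exactness at `F_n` says that `0 → F_n → F_{n-1}` is `S`-exact
(with `F_{-1} = M`). -/
structure SFlatSResolution {R : Type u} [CommRing R] (S : Submonoid R)
    (M : Type u) [AddCommGroup M] [Module R M] (n : ℕ) where
  F : ℕ → ModuleCat.{u} R
  d : ∀ i : ℕ, F (i + 1) →ₗ[R] F i
  ε : F 0 →ₗ[R] M
  flat : ∀ i ≤ n, IsSFlat S (F i)
  zero : ∀ i > n, Subsingleton (F i)
  exact_M : SExact S ε (0 : M →ₗ[R] PUnit.{u+1})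
  exact_zero : SExact S (d 0) ε
  exact_succ : ∀ i : ℕ, SExact S (d (i + 1)) (d i)

/-- The `S`-flat dimension of `M`: the length of a shortest `S`-flat `S`-resolution of `M`,
and `⊤` if there is none of finite length. -/
noncomputable def sFlatDim {R : Type u} [CommRing R] (S : Submonoid R)
    (M : Type u) [AddCommGroup M] [Module R M] : ℕ∞ :=
  sInf {k : ℕ∞ | ∃ n : ℕ, k = (n : ℕ∞) ∧ Nonempty (SFlatSResolution S M n)}

/-- The `S`-weak global dimension of `R`: the supremum of the `S`-flat dimensions of all
`R`-modules. -/
noncomputable def sWeakGlobalDim (R : Type u) [CommRing R] (S : Submonoid R) : ℕ∞ :=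
  ⨆ M : ModuleCat.{u} R, sFlatDim S M

/-!
Write `M⋆` for the character module of `M`. Since `Ext^n(N, M⋆)` is the character module of
`Tor_n(N, M)`, the module `M` has `S`-flat dimension at most `n` if and only if all
`Ext^{n+1}(N, M⋆)` are uniformly `S`-torsion.

Let `R' = R/aR`. If `a` is regular on `N` and `aX = 0`, then `Ext_R^{k+1}(N, X)` and
`Ext_{R'}^{k+1}(N/aN, X)` agree. Over `R`, every module `N` has a syzygy `K` inside a free module,
on which `a` is regular, so shifting dimensions turns `Ext_R^{k+2}(N, M⋆)` into
`Ext_{R'}^{k+1}(K/aK, M⋆)`; this bounds the dimension of `M` over `R` by one more than that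
over `R'`. Conversely, if `N` is an `R'`-module, multiplication by `a` embeds `N` into `K/aK`.
Hence if `Ext_R^{k+2}(-, M⋆)` and `Ext_{R'}^{k+2}(-, M⋆)` are uniformly torsion, then so is
`Ext_{R'}^{k+1}(-, M⋆)`, which means that the upper bound is attained. In dimension zero,
an `S`-flat `M` with `aM = 0` is uniformly `S`-torsion, as one sees by tensoring `a : R → R`
with `M`.
-/

section TorsionExt

open CategoryTheory Abelian

variable {R : Type u} [CommRing R] {S : Submonoid R}

lemma IsUniformlySTorsion.of_exact {U V W : Type u} [AddCommGroup U] [AddCommGroup V]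
    [AddCommGroup W] [Module R U] [Module R V] [Module R W] {f : U →ₗ[R] V} {g : V →ₗ[R] W}
    (hfg : LinearMap.ker g ≤ LinearMap.range f) (hU : IsUniformlySTorsion S U)
    (hW : IsUniformlySTorsion S W) : IsUniformlySTorsion S V := by
  obtain ⟨s, hs, hsU⟩ := hU
  obtain ⟨t, ht, htW⟩ := hW
  refine ⟨s * t, S.mul_mem hs ht, fun v ↦ ?_⟩
  have hv : g (t • v) = 0 := by rw [map_smul, htW]
  obtain ⟨u, hu⟩ := hfg hv
  rw [mul_smul, ← hu, ← map_smul, hsU, map_zero]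

lemma IsUniformlySTorsion.of_subsingleton {T : Type u} [AddCommGroup T] [Module R T]
    [Subsingleton T] : IsUniformlySTorsion S T :=
  ⟨1, S.one_mem, fun _ ↦ Subsingleton.elim _ _⟩

lemma exists_free_cover (R : Type u) [CommRing R] (N : Type u) [AddCommGroup N] [Module R N] :
    ∃ (P : Type u) (_ : AddCommGroup P) (_ : Module R P) (p : P →ₗ[R] N),
      Module.Free R P ∧ Function.Surjective p :=
  ⟨N →₀ R, inferInstance, inferInstance, Finsupp.linearCombination R id, inferInstance,
    Finsupp.linearCombination_id_surjective R N⟩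

lemma shortExact_of_exact {A B C : Type u} [AddCommGroup A] [Module R A] [AddCommGroup B]
    [Module R B] [AddCommGroup C] [Module R C] {f : A →ₗ[R] B} {g : B →ₗ[R] C}
    (hf : Function.Injective f) (hfg : Function.Exact f g) (hg : Function.Surjective g) :
    (ShortComplex.moduleCatMk f g hfg.linearMap_comp_eq_zero).ShortExact :=
  ModuleCat.shortComplex_shortExact _ hfg hf hg

/-- The module `Ext^k(N, X)` over `R` is uniformly `S`-torsion. -/
def HasSTorsionExt (S : Submonoid R) (N X : Type u) [AddCommGroup N] [Module R N]
    [AddCommGroup X] [Module R X] (k : ℕ) : Prop :=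
  IsUniformlySTorsion S (Ext (ModuleCat.of R N) (ModuleCat.of R X) k)

namespace HasSTorsionExt

variable {A B C N X : Type u} [AddCommGroup A] [Module R A] [AddCommGroup B] [Module R B]
  [AddCommGroup C] [Module R C] [AddCommGroup N] [Module R N] [AddCommGroup X] [Module R X]
  {f : A →ₗ[R] B} {g : B →ₗ[R] C}

lemma of_projective [Module.Projective R N] (k : ℕ) : HasSTorsionExt S N X (k + 1) := by
  have : Projective (ModuleCat.of R N) := (IsProjective.iff_projective _).mp inferInstance
  exact ⟨1, S.one_mem, fun e ↦ by rw [Ext.eq_zero_of_projective e, smul_zero]⟩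

lemma of_injective [Module.Injective R X] (k : ℕ) : HasSTorsionExt S N X (k + 1) := by
  have : Injective (ModuleCat.of R X) := Module.injective_object_of_injective_module R X
  exact ⟨1, S.one_mem, fun e ↦ by rw [Ext.eq_zero_of_injective e, smul_zero]⟩

lemma of_comp_eq_smul {Y : Type u} [AddCommGroup Y] [Module R Y] {i : X →ₗ[R] Y}
    {p : Y →ₗ[R] X} {s : R} (hs : s ∈ S) (hpi : p ∘ₗ i = s • LinearMap.id) {k : ℕ}
    (hY : HasSTorsionExt S N Y k) : HasSTorsionExt S N X k := by
  obtain ⟨t, ht, hY⟩ := hY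
  have hpi' : ModuleCat.ofHom i ≫ ModuleCat.ofHom p = s • 𝟙 (ModuleCat.of R X) :=
    ModuleCat.hom_ext hpi
  refine ⟨t * s, S.mul_mem ht hs, fun e ↦ ?_⟩
  calc (t * s) • e
      = t • e.comp (Ext.mk₀ (ModuleCat.ofHom i ≫ ModuleCat.ofHom p)) (add_zero k) := by
        rw [mul_smul, Ext.smul_eq_comp_mk₀ e s, hpi']
    _ = (t • e.comp (Ext.mk₀ (ModuleCat.ofHom i)) (add_zero k)).comp
          (Ext.mk₀ (ModuleCat.ofHom p)) (add_zero k) := by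
        rw [← Ext.mk₀_comp_mk₀, Ext.smul_comp, Ext.comp_assoc_of_third_deg_zero]
    _ = 0 := by rw [hY, Ext.zero_comp]

lemma of_isUniformlySTorsion (hX : IsUniformlySTorsion S X) (k : ℕ) : HasSTorsionExt S N X k := by
  obtain ⟨s, hs, hX⟩ := hX
  have hzero : (0 : PUnit.{u + 1} →ₗ[R] X) ∘ₗ 0 = s • LinearMap.id :=
    LinearMap.ext fun x ↦ (hX x).symm
  refine .of_comp_eq_smul hs hzero ⟨1, S.one_mem, fun e ↦ ?_⟩
  rw [one_smul, ← Ext.comp_mk₀_id e, (ModuleCat.isZero_of_subsingleton _).eq_of_src (𝟙 _) 0,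
    Ext.mk₀_zero, Ext.comp_zero]

section LongExactSequence

variable (hf : Function.Injective f) (hfg : Function.Exact f g) (hg : Function.Surjective g)

include hf hfg hg

lemma contravariant₁ {k : ℕ} (hB : HasSTorsionExt S B X k) (hC : HasSTorsionExt S C X (k + 1)) :
    HasSTorsionExt S A X k :=
  IsUniformlySTorsion.of_exact
    (f := Ext.precompOfLinear (Ext.mk₀ (ModuleCat.ofHom f)) R (ModuleCat.of R X) (zero_add k))
    (g := Ext.precompOfLinear (shortExact_of_exact hf hfg hg).extClass R (ModuleCat.of R X)
      (add_comm 1 k))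
    (fun e he ↦ Ext.contravariant_sequence_exact₁ (shortExact_of_exact hf hfg hg) _ e
      (add_comm 1 k) he)
    hB hC

lemma contravariant₃ {k : ℕ} (hA : HasSTorsionExt S A X k) (hB : HasSTorsionExt S B X (k + 1)) :
    HasSTorsionExt S C X (k + 1) :=
  IsUniformlySTorsion.of_exact
    (f := Ext.precompOfLinear (shortExact_of_exact hf hfg hg).extClass R (ModuleCat.of R X)
      (add_comm 1 k))
    (g := Ext.precompOfLinear (Ext.mk₀ (ModuleCat.ofHom g)) R (ModuleCat.of R X)
      (zero_add (k + 1)))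
    (fun e he ↦ Ext.contravariant_sequence_exact₃ (shortExact_of_exact hf hfg hg) _ e he
      (add_comm 1 k))
    hA hB

lemma covariant₁ {k : ℕ} (hC : HasSTorsionExt S N C k) (hB : HasSTorsionExt S N B (k + 1)) :
    HasSTorsionExt S N A (k + 1) :=
  IsUniformlySTorsion.of_exact
    (f := Ext.postcompOfLinear (shortExact_of_exact hf hfg hg).extClass R (ModuleCat.of R N)
      (rfl : k + 1 = k + 1))
    (g := Ext.postcompOfLinear (Ext.mk₀ (ModuleCat.ofHom f)) R (ModuleCat.of R N)
      (add_zero (k + 1)))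
    (fun e he ↦ Ext.covariant_sequence_exact₁ _ (shortExact_of_exact hf hfg hg) e he rfl) hC hB

lemma covariant₃ {k : ℕ} (hB : HasSTorsionExt S N B k) (hA : HasSTorsionExt S N A (k + 1)) :
    HasSTorsionExt S N C k :=
  IsUniformlySTorsion.of_exact
    (f := Ext.postcompOfLinear (Ext.mk₀ (ModuleCat.ofHom g)) R (ModuleCat.of R N) (add_zero k))
    (g := Ext.postcompOfLinear (shortExact_of_exact hf hfg hg).extClass R (ModuleCat.of R N)
      (rfl : k + 1 = k + 1))
    (fun e he ↦ Ext.covariant_sequence_exact₃ _ (shortExact_of_exact hf hfg hg) e rfl he) hB hA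

lemma exists_extension (hC : HasSTorsionExt S C X 1) :
    ∃ s ∈ S, ∀ φ : A →ₗ[R] X, ∃ ψ : B →ₗ[R] X, ψ ∘ₗ f = s • φ := by
  obtain ⟨s, hs, hC⟩ := hC
  refine ⟨s, hs, fun φ ↦ ?_⟩
  let δ : Ext (ModuleCat.of R C) (ModuleCat.of R A) 1 := (shortExact_of_exact hf hfg hg).extClass
  have hobstruction : δ.comp (Ext.mk₀ (s • ModuleCat.ofHom φ)) (add_zero 1) = 0 := by
    rw [Ext.mk₀_smul, Ext.comp_smul, hC]
  obtain ⟨x, hx⟩ := Ext.contravariant_sequence_exact₁ (shortExact_of_exact hf hfg hg) _ _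
    (add_zero 1) hobstruction
  obtain ⟨ψ, rfl⟩ := (Ext.mk₀_bijective _ _).2 x
  rw [Ext.mk₀_comp_mk₀] at hx
  exact ⟨ψ.hom, congrArg ModuleCat.Hom.hom ((Ext.mk₀_bijective _ _).1 hx)⟩

variable [Module.Projective R B]

lemma one_iff :
    HasSTorsionExt S C X 1 ↔
      ∃ s ∈ S, ∀ φ : A →ₗ[R] X, ∃ ψ : B →ₗ[R] X, ψ ∘ₗ f = s • φ := by
  refine ⟨exists_extension hf hfg hg, fun ⟨s, hs, H⟩ ↦ ⟨s, hs, fun e ↦ ?_⟩⟩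
  have hB : Projective (ModuleCat.of R B) := (IsProjective.iff_projective _).mp inferInstance
  let δ : Ext (ModuleCat.of R C) (ModuleCat.of R A) 1 := (shortExact_of_exact hf hfg hg).extClass
  obtain ⟨x, rfl⟩ := Ext.contravariant_sequence_exact₃ (shortExact_of_exact hf hfg hg) _ e
    (Ext.eq_zero_of_projective (P := ModuleCat.of R B) _) (add_zero 1)
  obtain ⟨φ, rfl⟩ := (Ext.mk₀_bijective (ModuleCat.of R A) _).2 x
  obtain ⟨ψ, hψ⟩ := H φ.hom
  have hψ' : ModuleCat.ofHom f ≫ ModuleCat.ofHom ψ = s • φ := ModuleCat.hom_ext hψ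
  calc s • δ.comp (Ext.mk₀ φ) (add_zero 1)
      = δ.comp (Ext.mk₀ (ModuleCat.ofHom f ≫ ModuleCat.ofHom ψ)) (add_zero 1) := by
        rw [hψ', Ext.mk₀_smul, Ext.comp_smul]
    _ = 0 := by
        rw [← Ext.mk₀_comp_mk₀]
        exact (shortExact_of_exact hf hfg hg).extClass_comp_assoc _

lemma succ_iff (k : ℕ) : HasSTorsionExt S C X (k + 2) ↔ HasSTorsionExt S A X (k + 1) :=
  ⟨contravariant₁ hf hfg hg (of_projective k),
    fun h ↦ contravariant₃ hf hfg hg h (of_projective (k + 1))⟩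

end LongExactSequence

end HasSTorsionExt

end TorsionExt

section CharacterModule

variable {R : Type*} [CommRing R] {A B C F : Type*} [AddCommGroup A] [Module R A]
  [AddCommGroup B] [Module R B] [AddCommGroup C] [Module R C] [AddCommGroup F] [Module R F]

lemma exists_characterModule_dual_eq_iff (f : A →ₗ[R] B) (c : CharacterModule A) :
    (∃ d, CharacterModule.dual f d = c) ↔ ∀ x, f x = 0 → c x = 0 := by
  refine ⟨?_, fun hc ↦ ?_⟩
  · rintro ⟨d, rfl⟩ x hx
    exact (congrArg d hx).trans d.map_zero
  · let e : CharacterModule f.range := AddMonoidHom.liftOfSurjective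
      f.rangeRestrict.toAddMonoidHom f.surjective_rangeRestrict
      ⟨c, fun x hx ↦ hc x (congrArg Subtype.val hx)⟩
    obtain ⟨d, hd⟩ := CharacterModule.dual_surjective_of_injective _ f.range.injective_subtype e
    refine ⟨d, CharacterModule.ext _ fun x ↦ ?_⟩
    calc d (f x) = e (f.rangeRestrict x) := DFunLike.congr_fun hd (f.rangeRestrict x)
      _ = c x := AddMonoidHom.liftOfRightInverse_comp_apply _ _ _ _ x

lemma characterModule_dual_exact {f : A →ₗ[R] B} {g : B →ₗ[R] C} (hfg : Function.Exact f g) :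
    Function.Exact (CharacterModule.dual g) (CharacterModule.dual f) := by
  intro c
  rw [Set.mem_range, exists_characterModule_dual_eq_iff]
  refine ⟨fun hc x hx ↦ ?_, fun hc ↦ CharacterModule.ext _ fun x ↦ ?_⟩
  · obtain ⟨y, rfl⟩ := (hfg x).1 hx
    exact DFunLike.congr_fun hc y
  · exact hc _ (hfg.apply_apply_eq_zero x)

lemma forall_rTensor_eq_zero_iff_exists_extension (f : A →ₗ[R] B) (s : R) :
    (∀ z, f.rTensor F z = 0 → s • z = 0) ↔
      ∀ φ : A →ₗ[R] CharacterModule F, ∃ ψ : B →ₗ[R] CharacterModule F, ψ ∘ₗ f = s • φ := by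
  have hdual (ψ : B →ₗ[R] CharacterModule F) :
      CharacterModule.dual (f.rTensor F) (CharacterModule.homEquiv ψ) =
        CharacterModule.homEquiv (ψ ∘ₗ f) := by
    rw [← LinearEquiv.symm_apply_eq]
    rfl
  calc (∀ z, f.rTensor F z = 0 → s • z = 0)
      ↔ ∀ z, f.rTensor F z = 0 → ∀ c : CharacterModule (A ⊗[R] F), (s • c) z = 0 := by
        refine forall₂_congr fun z _ ↦ ⟨fun hz c ↦ ?_, fun hz ↦ ?_⟩
        · rw [CharacterModule.smul_apply, hz]
          exact c.map_zero
        · exact CharacterModule.eq_zero_of_character_apply hz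
    _ ↔ ∀ c : CharacterModule (A ⊗[R] F), ∃ d, CharacterModule.dual (f.rTensor F) d = s • c := by
        simp only [exists_characterModule_dual_eq_iff]
        exact ⟨fun h c z hz ↦ h z hz c, fun h z hz c ↦ h c z hz⟩
    _ ↔ _ := by
        rw [CharacterModule.homEquiv.surjective.forall]
        simp only [CharacterModule.homEquiv.surjective.exists, hdual, ← map_smul,
          EmbeddingLike.apply_eq_iff_eq]

end CharacterModule

section FlatDimension

variable {R : Type u} [CommRing R] {S : Submonoid R}

lemma IsUniformlySTorsion.characterModule {M : Type u} [AddCommGroup M] [Module R M]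
    (hM : IsUniformlySTorsion S M) : IsUniformlySTorsion S (CharacterModule M) := by
  obtain ⟨s, hs, hM⟩ := hM
  exact ⟨s, hs, fun c ↦ CharacterModule.ext _ fun x ↦ by
    rw [CharacterModule.smul_apply, hM]; exact c.map_zero⟩

lemma sExact_zero_left_iff {A B K : Type u} [AddCommGroup A] [Module R A] [AddCommGroup B]
    [Module R B] [AddCommGroup K] [Module R K] {f : A →ₗ[R] B} :
    SExact S (0 : K →ₗ[R] A) f ↔ ∃ s ∈ S, ∀ x, f x = 0 → s • x = 0 := by
  simp only [SExact, LinearMap.range_zero, LinearMap.mem_ker, Submodule.mem_bot]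
  refine exists_congr fun s ↦ and_congr_right fun _ ↦ and_iff_left ?_
  rintro y rfl
  rw [smul_zero, map_zero]

lemma sExact_zero_right_iff {B C L : Type u} [AddCommGroup B] [Module R B] [AddCommGroup C]
    [Module R C] [AddCommGroup L] [Module R L] {g : B →ₗ[R] C} :
    SExact S g (0 : C →ₗ[R] L) ↔ ∃ s ∈ S, ∀ y, ∃ x, g x = s • y := by
  simp only [SExact, LinearMap.ker_zero, Submodule.mem_top, true_implies, LinearMap.mem_range,
    implies_true, and_true]

/-- The `S`-analogue of flat dimension being less than `n`, encoded without resolutions: all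
modules `Ext^n(N, M⋆)` are uniformly `S`-torsion, where `M⋆` is the character module of `M`.
Since `Ext^n(N, M⋆)` is the character module of `Tor_n(N, M)`, this is a form of the vanishing
of `Tor_n(-, M)` up to `S`-torsion. For `n = 0` it says that `M` is uniformly `S`-torsion. -/
def HasSFlatDimLT (S : Submonoid R) (M : Type u) [AddCommGroup M] [Module R M] (n : ℕ) : Prop :=
  ∀ (N : Type u) [AddCommGroup N] [Module R N], HasSTorsionExt S N (CharacterModule M) n

namespace HasSFlatDimLT

variable {A B C M : Type u} [AddCommGroup A] [Module R A] [AddCommGroup B] [Module R B]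
  [AddCommGroup C] [Module R C] [AddCommGroup M] [Module R M] {f : A →ₗ[R] B} {g : B →ₗ[R] C}
  {n : ℕ}

lemma of_isUniformlySTorsion (hM : IsUniformlySTorsion S M) (n : ℕ) : HasSFlatDimLT S M n :=
  fun _ _ _ ↦ .of_isUniformlySTorsion hM.characterModule n

lemma of_projective [Module.Projective R M] (n : ℕ) : HasSFlatDimLT S M (n + 1) := by
  have : Module.Injective R (CharacterModule M) :=
    Module.Flat.iff_characterModule_injective.1 inferInstance
  exact fun _ _ _ ↦ .of_injective n

lemma succ (hM : HasSFlatDimLT S M n) : HasSFlatDimLT S M (n + 1) := by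
  intro N _ _
  obtain ⟨P, _, _, p, _, hp⟩ := exists_free_cover R N
  exact .contravariant₃ p.ker.injective_subtype p.exact_subtype_ker_map hp (hM p.ker)
    (.of_projective n)

lemma mono {m : ℕ} (hM : HasSFlatDimLT S M m) (hmn : m ≤ n) : HasSFlatDimLT S M n := by
  induction n, hmn using Nat.le_induction with
  | base => exact hM
  | succ n _ ih => exact ih.succ

lemma of_comp_eq_smul {s : R} (hs : s ∈ S) {r : B →ₗ[R] A} (hfr : f ∘ₗ r = s • LinearMap.id)
    (hA : HasSFlatDimLT S A n) : HasSFlatDimLT S B n := by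
  refine fun N _ _ ↦ .of_comp_eq_smul (i := CharacterModule.dual f) (p := CharacterModule.dual r)
    hs (LinearMap.ext fun c ↦ CharacterModule.ext _ fun x ↦ ?_) (hA N)
  exact congrArg c (LinearMap.congr_fun hfr x)

lemma left_of_exact (hf : Function.Injective f) (hfg : Function.Exact f g)
    (hg : Function.Surjective g) (hB : HasSFlatDimLT S B n) (hC : HasSFlatDimLT S C (n + 1)) :
    HasSFlatDimLT S A n := fun N _ _ ↦
  .covariant₃ (CharacterModule.dual_injective_of_surjective g hg)
    (characterModule_dual_exact hfg) (CharacterModule.dual_surjective_of_injective f hf)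
    (hB N) (hC N)

lemma right_of_exact (hf : Function.Injective f) (hfg : Function.Exact f g)
    (hg : Function.Surjective g) (hA : HasSFlatDimLT S A n) (hB : HasSFlatDimLT S B (n + 1)) :
    HasSFlatDimLT S C (n + 1) := fun N _ _ ↦
  .covariant₁ (CharacterModule.dual_injective_of_surjective g hg)
    (characterModule_dual_exact hfg) (CharacterModule.dual_surjective_of_injective f hf)
    (hA N) (hB N)

lemma of_range (hg : SExact S g (0 : C →ₗ[R] PUnit.{u + 1})) (h : HasSFlatDimLT S g.range n) :
    HasSFlatDimLT S C n := by
  obtain ⟨s, hs, hg⟩ := sExact_zero_right_iff.1 hg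
  exact .of_comp_eq_smul hs (f := g.range.subtype)
    (r := (LinearMap.lsmul R C s).codRestrict g.range hg) rfl h

lemma ker_of_range (hfg : SExact S f g) (h : HasSFlatDimLT S f.range n) :
    HasSFlatDimLT S g.ker n := by
  obtain ⟨s, hs, hker, hrange⟩ := hfg
  let toKer : f.range →ₗ[R] g.ker := (LinearMap.lsmul R B s).restrict hrange
  let toRange : g.ker →ₗ[R] f.range := (LinearMap.lsmul R B s).restrict hker
  have hcomp : toKer ∘ₗ toRange = (s * s) • LinearMap.id :=
    LinearMap.ext fun x ↦ Subtype.ext (mul_smul s s (x : B)).symm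
  exact .of_comp_eq_smul (S.mul_mem hs hs) hcomp h

lemma of_sExact (hfg : SExact S f g) (hg : SExact S g (0 : C →ₗ[R] PUnit.{u + 1}))
    (hA : HasSFlatDimLT S f.range n) (hB : HasSFlatDimLT S B (n + 1)) :
    HasSFlatDimLT S C (n + 1) :=
  .of_range hg <| .right_of_exact g.ker.injective_subtype
    (LinearMap.exact_iff.2 (by rw [LinearMap.ker_rangeRestrict, Submodule.range_subtype]))
    g.surjective_rangeRestrict (.ker_of_range hfg hA) hB

end HasSFlatDimLT

end FlatDimension

section SFlat

variable {R : Type u} [CommRing R] {S : Submonoid R} {A B C F : Type u} [AddCommGroup A]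
  [Module R A] [AddCommGroup B] [Module R B] [AddCommGroup C] [Module R C] [AddCommGroup F]
  [Module R F] {f : A →ₗ[R] B} {g : B →ₗ[R] C}

lemma SExact.of_exact (hfg : Function.Exact f g) : SExact S f g :=
  ⟨1, S.one_mem, fun y hy ↦ (one_smul R y).symm ▸ (hfg y).1 hy,
    fun y hy ↦ (one_smul R y).symm ▸ (hfg y).2 hy⟩

lemma IsSFlat.exists_forall_smul_eq_zero (hF : IsSFlat S F) (hf : Function.Injective f) :
    ∃ s ∈ S, ∀ z, f.rTensor F z = 0 → s • z = 0 :=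
  sExact_zero_left_iff.1 (hF A B (B ⧸ f.range) f f.range.mkQ
    { left := .of_exact ((f.exact_zero_iff_injective _).2 hf)
      middle := .of_exact f.exact_map_mkQ_range
      right := .of_exact <|
        (f.range.mkQ.exact_zero_iff_surjective _).2 f.range.mkQ_surjective }).left

lemma IsSFlat.hasSFlatDimLT_one (hF : IsSFlat S F) : HasSFlatDimLT S F 1 := by
  intro N _ _
  obtain ⟨P, _, _, p, _, hp⟩ := exists_free_cover R N
  rw [HasSTorsionExt.one_iff p.ker.injective_subtype p.exact_subtype_ker_map hp]
  simpa only [forall_rTensor_eq_zero_iff_exists_extension] using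
    hF.exists_forall_smul_eq_zero p.ker.injective_subtype

lemma HasSFlatDimLT.exists_forall_smul_eq_zero (hF : HasSFlatDimLT S F 1)
    (hf : Function.Injective f) : ∃ s ∈ S, ∀ z, f.rTensor F z = 0 → s • z = 0 := by
  simp only [forall_rTensor_eq_zero_iff_exists_extension]
  exact HasSTorsionExt.exists_extension hf f.exact_map_mkQ_range f.range.mkQ_surjective (hF _)

lemma HasSFlatDimLT.exists_smul_mem_range_rTensor_ker (hF : HasSFlatDimLT S F 1) (g : B →ₗ[R] C) :
    ∃ s ∈ S, ∀ z, g.rTensor F z = 0 → s • z ∈ (g.ker.subtype.rTensor F).range := by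
  obtain ⟨s, hs, H⟩ := hF.exists_forall_smul_eq_zero g.range.injective_subtype
  have hexact : Function.Exact (g.ker.subtype.rTensor F) (g.rangeRestrict.rTensor F) :=
    rTensor_exact F
      (LinearMap.exact_iff.2 (by rw [LinearMap.ker_rangeRestrict, Submodule.range_subtype]))
      g.surjective_rangeRestrict
  refine ⟨s, hs, fun z hz ↦ (hexact _).1 ?_⟩
  rw [map_smul]
  refine H _ ?_
  rwa [← LinearMap.rTensor_comp_apply, show g.range.subtype ∘ₗ g.rangeRestrict = g from rfl]

lemma smul_rTensor_mem_range {s : R} {i : C →ₗ[R] B} (h : ∀ x, s • i x ∈ f.range)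
    (z : C ⊗[R] F) : s • i.rTensor F z ∈ (f.rTensor F).range := by
  induction z with
  | zero => rw [map_zero, smul_zero]; exact Submodule.zero_mem _
  | tmul x y =>
    obtain ⟨w, hw⟩ := h x
    exact ⟨w ⊗ₜ y, by rw [LinearMap.rTensor_tmul, hw, LinearMap.rTensor_tmul,
      TensorProduct.smul_tmul']⟩
  | add x y hx hy => rw [map_add, smul_add]; exact Submodule.add_mem _ hx hy

lemma SExact.rTensor (hfg : SExact S f g) (hF : HasSFlatDimLT S F 1) :
    SExact S (f.rTensor F) (g.rTensor F) := by
  obtain ⟨s, hs, hker, hrange⟩ := hfg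
  obtain ⟨t, ht, H⟩ := hF.exists_smul_mem_range_rTensor_ker g
  refine ⟨s * t, S.mul_mem hs ht, fun z hz ↦ ?_, ?_⟩
  · obtain ⟨w, hw⟩ := H z hz
    rw [mul_smul, ← hw]
    exact smul_rTensor_mem_range (i := g.ker.subtype) (fun x ↦ hker x x.2) w
  · rintro _ ⟨w, rfl⟩
    have hzero : s • g ∘ₗ f = 0 :=
      LinearMap.ext fun x ↦ (g.map_smul s (f x)).symm.trans (hrange (f x) ⟨x, rfl⟩)
    calc g.rTensor F ((s * t) • f.rTensor F w) = t • (s • g ∘ₗ f).rTensor F w := by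
          rw [mul_comm, mul_smul, map_smul, map_smul, LinearMap.rTensor_smul,
            LinearMap.rTensor_comp, LinearMap.smul_apply, LinearMap.comp_apply]
      _ = 0 := by rw [hzero, LinearMap.rTensor_zero, LinearMap.zero_apply, smul_zero]

lemma isSFlat_iff_hasSFlatDimLT_one : IsSFlat S F ↔ HasSFlatDimLT S F 1 where
  mp := IsSFlat.hasSFlatDimLT_one
  mpr hF A B C _ _ _ _ _ _ f g hfg :=
    { left := by
        simpa only [LinearMap.rTensor_zero, sExact_zero_left_iff] using hfg.left.rTensor hF
      middle := hfg.middle.rTensor hF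
      right := by
        simpa only [LinearMap.rTensor_zero, sExact_zero_right_iff] using hfg.right.rTensor hF }

end SFlat

section Resolution

variable {R : Type u} [CommRing R] {S : Submonoid R} {M P : Type u} [AddCommGroup M] [Module R M]
  [AddCommGroup P] [Module R P] {n : ℕ}

namespace SFlatSResolution

/-- The truncation `⋯ → F_2 → F_1 → Im d_0 → 0` of a resolution, which is one step shorter. -/
def tail (r : SFlatSResolution S M (n + 1)) : SFlatSResolution S (r.d 0).range n where
  F i := r.F (i + 1)
  d i := r.d (i + 1)
  ε := (r.d 0).rangeRestrict
  flat i hi := r.flat (i + 1) (by lia)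
  zero i hi := r.zero (i + 1) (by lia)
  exact_M := .of_exact <|
    ((r.d 0).rangeRestrict.exact_zero_iff_surjective _).2 (r.d 0).surjective_rangeRestrict
  exact_zero := by
    have := r.exact_succ 0
    rwa [SExact, ← LinearMap.ker_rangeRestrict (r.d 0)] at this
  exact_succ i := r.exact_succ (i + 1)

/-- The resolution of `M` obtained by splicing a resolution of the kernel of a surjection
`p : P → M`, with `P` an `S`-flat module, onto `p`. -/
def cons (p : P →ₗ[R] M) (hp : Function.Surjective p) (hP : IsSFlat S P)
    (r : SFlatSResolution S p.ker n) : SFlatSResolution S M (n + 1) where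
  F | 0 => ModuleCat.of R P
    | i + 1 => r.F i
  d | 0 => p.ker.subtype ∘ₗ r.ε
    | i + 1 => r.d i
  ε := p
  flat
    | 0, _ => hP
    | i + 1, hi => r.flat i (by lia)
  zero
    | 0, hi => by lia
    | i + 1, hi => r.zero i (by lia)
  exact_M := .of_exact ((p.exact_zero_iff_surjective _).2 hp)
  exact_zero := by
    obtain ⟨s, hs, h⟩ := sExact_zero_right_iff.1 r.exact_M
    refine ⟨s, hs, fun y hy ↦ ?_, ?_⟩
    · obtain ⟨x, hx⟩ := h ⟨y, hy⟩
      exact ⟨x, congrArg Subtype.val hx⟩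
    · rintro _ ⟨x, rfl⟩
      exact Submodule.smul_mem _ _ (r.ε x).2
  exact_succ
    | 0 => by
      have := r.exact_zero
      rwa [SExact, ← LinearMap.ker_comp_of_ker_eq_bot r.ε p.ker.ker_subtype] at this
    | i + 1 => r.exact_succ i

/-- The resolution of length zero of an `S`-flat module by itself. -/
def single (hM : IsSFlat S M) : SFlatSResolution S M 0 where
  F | 0 => ModuleCat.of R M
    | _ + 1 => ModuleCat.of R PUnit
  d _ := 0
  ε := LinearMap.id
  flat
    | 0, _ => hM
  zero
    | _ + 1, _ => inferInstanceAs (Subsingleton PUnit)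
  exact_M := .of_exact <|
    (LinearMap.id.exact_zero_iff_surjective _).2 Function.surjective_id
  exact_zero := .of_exact ((LinearMap.id.exact_zero_iff_injective _).2 Function.injective_id)
  exact_succ _ := .of_exact fun _ ↦
    ⟨fun _ ↦ ⟨0, Subsingleton.elim (α := PUnit) _ _⟩, fun _ ↦ rfl⟩

lemma hasSFlatDimLT (r : SFlatSResolution S M n) : HasSFlatDimLT S M (n + 1) := by
  induction n generalizing M with
  | zero =>
    have := r.zero 1 one_pos
    have : Subsingleton (r.d 0).range := (r.d 0).surjective_rangeRestrict.subsingleton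
    exact .of_sExact r.exact_zero r.exact_M (.of_isUniformlySTorsion .of_subsingleton 0)
      (r.flat 0 le_rfl).hasSFlatDimLT_one
  | succ n ih =>
    exact .of_sExact r.exact_zero r.exact_M (ih r.tail)
      ((r.flat 0 (by lia)).hasSFlatDimLT_one.mono (by lia))

end SFlatSResolution

lemma HasSFlatDimLT.nonempty_sFlatSResolution (hM : HasSFlatDimLT S M (n + 1)) :
    Nonempty (SFlatSResolution S M n) := by
  induction n generalizing M with
  | zero => exact ⟨.single (isSFlat_iff_hasSFlatDimLT_one.2 hM)⟩
  | succ n ih =>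
    obtain ⟨P, _, _, p, _, hp⟩ := exists_free_cover R M
    have hker : HasSFlatDimLT S p.ker (n + 1) :=
      .left_of_exact p.ker.injective_subtype p.exact_subtype_ker_map hp (.of_projective n) hM
    obtain ⟨r⟩ := ih hker
    exact ⟨r.cons p hp (isSFlat_iff_hasSFlatDimLT_one.2 (.of_projective 0))⟩

theorem sFlatDim_le_iff : sFlatDim S M ≤ n ↔ HasSFlatDimLT S M (n + 1) := by
  refine ⟨fun h ↦ ?_, fun h ↦ sInf_le ⟨n, rfl, h.nonempty_sFlatSResolution⟩⟩
  have hlt : sFlatDim S M < (n + 1 : ℕ) := h.trans_lt (by exact_mod_cast n.lt_succ_self)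
  obtain ⟨_, ⟨m, rfl, ⟨r⟩⟩, hm⟩ := sInf_lt_iff.1 hlt
  exact r.hasSFlatDimLT.mono (by exact_mod_cast hm)

end Resolution

section ChangeOfRings

/-- `R'` is the quotient of `R` by its non-zero-divisor `a`. The ring `R'` is arbitrary, rather
than `R ⧸ Ideal.span {a}`, so that only its `R`-algebra structure enters the arguments. -/
structure IsQuotientByRegular {R : Type u} [CommRing R] (a : R) (R' : Type u) [CommRing R']
    [Algebra R R'] : Prop where
  mem_nonZeroDivisors : a ∈ nonZeroDivisors R
  algebraMap_surjective : Function.Surjective (algebraMap R R')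
  ker_algebraMap : RingHom.ker (algebraMap R R') = Ideal.span {a}

variable {R R' : Type u} [CommRing R] [CommRing R'] [Algebra R R'] {S : Submonoid R} {a : R}

lemma isQuotientByRegular_quotient (ha : a ∈ nonZeroDivisors R) :
    IsQuotientByRegular a (R ⧸ Ideal.span {a}) where
  mem_nonZeroDivisors := ha
  algebraMap_surjective := Ideal.Quotient.mk_surjective
  ker_algebraMap := Ideal.mk_ker

instance characterModule_isScalarTower {M : Type*} [AddCommGroup M] [Module R M] [Module R' M]
    [IsScalarTower R R' M] : IsScalarTower R R' (CharacterModule M) :=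
  .of_algebraMap_smul fun r c ↦ CharacterModule.ext _ fun x ↦ by
    rw [CharacterModule.smul_apply, CharacterModule.smul_apply, algebraMap_smul]

lemma isUniformlySTorsion_map_algebraMap_iff {M : Type u} [AddCommGroup M] [Module R M]
    [Module R' M] [IsScalarTower R R' M] :
    IsUniformlySTorsion (S.map (algebraMap R R')) M ↔ IsUniformlySTorsion S M := by
  simp only [IsUniformlySTorsion, Submonoid.mem_map, exists_exists_and_eq_and, algebraMap_smul]

lemma forall_exists_extension_baseChange_iff {A B X : Type*} [AddCommGroup A] [Module R A]
    [AddCommGroup B] [Module R B] [AddCommGroup X] [Module R X] [Module R' X]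
    [IsScalarTower R R' X] (f : A →ₗ[R] B) (s : R) :
    (∀ φ : A →ₗ[R] X, ∃ ψ : B →ₗ[R] X, ψ ∘ₗ f = s • φ) ↔
      ∀ φ : R' ⊗[R] A →ₗ[R'] X, ∃ ψ : R' ⊗[R] B →ₗ[R'] X,
        ψ ∘ₗ f.baseChange R' = algebraMap R R' s • φ := by
  have hlift (φ : A →ₗ[R] X) (ψ : B →ₗ[R] X) :
      ψ ∘ₗ f = s • φ ↔
        LinearMap.liftBaseChangeEquiv R' ψ ∘ₗ f.baseChange R' =
          algebraMap R R' s • LinearMap.liftBaseChangeEquiv R' φ := by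
    rw [← (LinearMap.liftBaseChangeEquiv R').apply_eq_iff_eq]
    congr! 1 <;> ext x <;> simp
  simp only [(LinearMap.liftBaseChangeEquiv R').surjective.forall,
    (LinearMap.liftBaseChangeEquiv R').surjective.exists, hlift]

namespace IsQuotientByRegular

variable (h : IsQuotientByRegular a R')

include h

lemma smul_eq_zero {X : Type*} [AddCommGroup X] [Module R X] [Module R' X] [IsScalarTower R R' X]
    (x : X) : a • x = 0 := by
  have ha : algebraMap R R' a = 0 :=
    RingHom.mem_ker.1 (h.ker_algebraMap ▸ Ideal.mem_span_singleton_self a)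
  rw [← algebraMap_smul R' a x, ha, zero_smul]

lemma exact_lsmul_mk (N : Type*) [AddCommGroup N] [Module R N] :
    Function.Exact (LinearMap.lsmul R N a) (TensorProduct.mk R R' N 1) := by
  have hR : Function.Exact (LinearMap.lsmul R R a) (Algebra.linearMap R R') := fun r ↦ by
    rw [Algebra.linearMap_apply, ← RingHom.mem_ker, h.ker_algebraMap, Ideal.mem_span_singleton']
    simp only [Set.mem_range, LinearMap.lsmul_apply, smul_eq_mul, mul_comm]
  refine fun x ↦ ⟨fun hx ↦ ?_, ?_⟩
  · obtain ⟨z, hz⟩ := (rTensor_exact N hR h.algebraMap_surjective (1 ⊗ₜ x)).1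
      (by rwa [LinearMap.rTensor_tmul, Algebra.linearMap_apply, map_one])
    refine ⟨TensorProduct.lid R N z, ?_⟩
    have hlid : TensorProduct.lid R N ((LinearMap.lsmul R R a).rTensor N z) =
        a • TensorProduct.lid R N z := by
      rw [show LinearMap.lsmul R R a = a • LinearMap.id from rfl, LinearMap.rTensor_smul,
        LinearMap.smul_apply, LinearMap.rTensor_id, LinearMap.id_apply, map_smul]
    rw [LinearMap.lsmul_apply, ← hlid, hz, TensorProduct.lid_tmul, one_smul]
  · rintro ⟨y, rfl⟩
    exact (map_smul _ a y).trans (h.smul_eq_zero _)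

lemma isSMulRegular_of_flat (P : Type*) [AddCommGroup P] [Module R P] [Module.Flat R P] :
    IsSMulRegular P a :=
  Module.Flat.isSMulRegular_of_nonZeroDivisors h.mem_nonZeroDivisors

lemma baseChange_injective {A B C : Type*} [AddCommGroup A] [Module R A] [AddCommGroup B]
    [Module R B] [AddCommGroup C] [Module R C] {f : A →ₗ[R] B} {g : B →ₗ[R] C}
    (hf : Function.Injective f) (hfg : Function.Exact f g) (hC : IsSMulRegular C a) :
    Function.Injective (f.baseChange R') := by
  rw [injective_iff_map_eq_zero]
  intro z hz
  obtain ⟨x, rfl⟩ := TensorProduct.mk_surjective R A R' h.algebraMap_surjective z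
  obtain ⟨y, hy⟩ := (h.exact_lsmul_mk B (f x)).1 hz
  have hgy : g y = 0 := hC.right_eq_zero_of_smul <| by
    rw [← map_smul]
    exact (congrArg g hy).trans (hfg.apply_apply_eq_zero x)
  obtain ⟨x', rfl⟩ := (hfg y).1 hgy
  exact (h.exact_lsmul_mk A x).2 ⟨x', hf ((f.map_smul a x').trans hy)⟩

lemma hasSTorsionExt_iff {N X : Type u} [AddCommGroup N] [Module R N] [AddCommGroup X]
    [Module R X] [Module R' X] [IsScalarTower R R' X] (hN : IsSMulRegular N a) (k : ℕ) :
    HasSTorsionExt S N X (k + 1) ↔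
      HasSTorsionExt (S.map (algebraMap R R')) (R' ⊗[R] N) X (k + 1) := by
  -- A free presentation of `N` stays exact modulo `a`, and `Hom_R(-, X) = Hom_R'(R' ⊗ -, X)`.
  obtain ⟨P, _, _, p, _, hp⟩ := exists_free_cover R N
  have hK : IsSMulRegular p.ker a := (h.isSMulRegular_of_flat P).submodule p.ker
  have hexact := p.exact_subtype_ker_map
  have hinj' := h.baseChange_injective p.ker.injective_subtype hexact hN
  have hexact' : Function.Exact (p.ker.subtype.baseChange R') (p.baseChange R') :=
    lTensor_exact R' hexact hp
  have hp' : Function.Surjective (p.baseChange R') := LinearMap.baseChange_surjective R' hp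
  cases k with
  | zero =>
    rw [HasSTorsionExt.one_iff p.ker.injective_subtype hexact hp,
      HasSTorsionExt.one_iff hinj' hexact' hp']
    simp only [Submonoid.mem_map, exists_exists_and_eq_and]
    exact exists_congr fun s ↦ and_congr_right fun _ ↦
      forall_exists_extension_baseChange_iff p.ker.subtype s
  | succ k =>
    rw [HasSTorsionExt.succ_iff p.ker.injective_subtype hexact hp,
      HasSTorsionExt.succ_iff hinj' hexact' hp']
    exact hasSTorsionExt_iff hK k

lemma exists_injective_baseChange_ker {P Y : Type*} [AddCommGroup P] [Module R P]
    [Module.Flat R P] [AddCommGroup Y] [Module R Y] [Module R' Y] [IsScalarTower R R' Y]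
    {q : P →ₗ[R] Y} (hq : Function.Surjective q) :
    ∃ j : Y →ₗ[R'] R' ⊗[R] q.ker, Function.Injective j := by
  -- `j (q x) = 1 ⊗ a x`; it kills only `q.ker`, since `a` cancels on `P`.
  let mulA : P →ₗ[R] q.ker := (LinearMap.lsmul R P a).codRestrict q.ker fun x ↦ by
    rw [LinearMap.mem_ker, LinearMap.lsmul_apply, map_smul, h.smul_eq_zero]
  let m : P →ₗ[R] R' ⊗[R] q.ker := TensorProduct.mk R R' q.ker 1 ∘ₗ mulA
  have hker : m.ker = q.ker := by
    ext x
    refine (h.exact_lsmul_mk q.ker (mulA x)).trans ⟨?_, fun hx ↦ ⟨⟨x, hx⟩, rfl⟩⟩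
    rintro ⟨y, hy⟩
    rw [← h.isSMulRegular_of_flat P (congrArg Subtype.val hy)]
    exact y.2
  let e : Y ≃ₗ[R] m.range := (q.quotKerEquivOfSurjective hq).symm ≪≫ₗ
    Submodule.quotEquivOfEq _ _ hker.symm ≪≫ₗ m.quotKerEquivRange
  exact ⟨LinearMap.extendScalarsOfSurjective h.algebraMap_surjective
    (m.range.subtype ∘ₗ e.toLinearMap), m.range.injective_subtype.comp e.injective⟩

end IsQuotientByRegular

end ChangeOfRings

section FlatDimensionModRegular

variable {R R' : Type u} [CommRing R] [CommRing R'] [Algebra R R'] {S : Submonoid R} {a : R}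
  {M : Type u} [AddCommGroup M] [Module R M] [Module R' M] [IsScalarTower R R' M] {n : ℕ}

namespace IsQuotientByRegular

variable (h : IsQuotientByRegular a R')

include h

lemma hasSFlatDimLT_of_map (hM : HasSFlatDimLT (S.map (algebraMap R R')) M (n + 1)) :
    HasSFlatDimLT S M (n + 2) := by
  intro N _ _
  obtain ⟨P, _, _, p, _, hp⟩ := exists_free_cover R N
  have hK : IsSMulRegular p.ker a := (h.isSMulRegular_of_flat P).submodule p.ker
  rw [HasSTorsionExt.succ_iff p.ker.injective_subtype p.exact_subtype_ker_map hp,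
    h.hasSTorsionExt_iff hK]
  exact hM _

lemma hasSFlatDimLT_map (hM : HasSFlatDimLT S M (n + 2))
    (hM' : HasSFlatDimLT (S.map (algebraMap R R')) M (n + 2)) :
    HasSFlatDimLT (S.map (algebraMap R R')) M (n + 1) := by
  intro Y _ _
  let _ : Module R Y := Module.compHom Y (algebraMap R R')
  have : IsScalarTower R R' Y := .of_algebraMap_smul fun _ _ ↦ rfl
  obtain ⟨P, _, _, q, _, hq⟩ := exists_free_cover R Y
  have hK : HasSTorsionExt (S.map (algebraMap R R')) (R' ⊗[R] q.ker) (CharacterModule M)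
      (n + 1) := by
    rw [← h.hasSTorsionExt_iff ((h.isSMulRegular_of_flat P).submodule q.ker),
      ← HasSTorsionExt.succ_iff q.ker.injective_subtype q.exact_subtype_ker_map hq]
    exact hM Y
  obtain ⟨j, hj⟩ := h.exists_injective_baseChange_ker hq
  exact .contravariant₁ hj j.exact_map_mkQ_range j.range.mkQ_surjective hK (hM' _)

lemma isUniformlySTorsion_of_hasSFlatDimLT_one (hM : HasSFlatDimLT S M 1) :
    IsUniformlySTorsion S M := by
  have hinj : Function.Injective (LinearMap.lsmul R R a) := fun _ _ ↦
    (mul_cancel_left_mem_nonZeroDivisors h.mem_nonZeroDivisors).1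
  obtain ⟨s, hs, H⟩ := hM.exists_forall_smul_eq_zero hinj
  refine ⟨s, hs, fun x ↦ ?_⟩
  have hx : (LinearMap.lsmul R R a).rTensor M (1 ⊗ₜ x) = 0 := by
    rw [LinearMap.rTensor_tmul, LinearMap.lsmul_apply, TensorProduct.smul_tmul, h.smul_eq_zero,
      TensorProduct.tmul_zero]
  simpa using congrArg (TensorProduct.lid R M) (H _ hx)

theorem sFlatDim_eq_add_one (hM : ¬ IsUniformlySTorsion S M)
    (hfin : sFlatDim (S.map (algebraMap R R')) M < ⊤) :
    sFlatDim S M = sFlatDim (S.map (algebraMap R R')) M + 1 := by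
  obtain ⟨n, hn⟩ := ENat.ne_top_iff_exists.1 hfin.ne
  have hM' : HasSFlatDimLT (S.map (algebraMap R R')) M (n + 1) := sFlatDim_le_iff.1 hn.ge
  have hle : sFlatDim S M ≤ (n + 1 : ℕ) := sFlatDim_le_iff.2 (h.hasSFlatDimLT_of_map hM')
  have hlt : ¬ sFlatDim S M ≤ n := fun hle ↦ by
    rw [sFlatDim_le_iff] at hle
    cases n with
    | zero => exact hM (h.isUniformlySTorsion_of_hasSFlatDimLT_one hle)
    | succ n =>
      have hdrop := sFlatDim_le_iff.2 (h.hasSFlatDimLT_map hle hM')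
      rw [← hn, Nat.cast_le] at hdrop
      lia
  rw [← hn]
  exact le_antisymm hle (Order.add_one_le_of_lt (not_le.1 hlt))

end IsQuotientByRegular

lemma exists_sFlatDim_eq_sWeakGlobalDim (hS : 0 ∉ S) (hfin : sWeakGlobalDim R S < ⊤) :
    ∃ M : ModuleCat.{u} R, ¬ IsUniformlySTorsion S M ∧ sFlatDim S M = sWeakGlobalDim R S := by
  obtain ⟨M, hM : sFlatDim S M = sWeakGlobalDim R S⟩ := ENat.exists_eq_iSup_of_lt_top hfin
  by_cases hT : IsUniformlySTorsion S M
  · have hzero : sFlatDim S M = 0 :=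
      nonpos_iff_eq_zero.1 (sFlatDim_le_iff.2 (.of_isUniformlySTorsion hT 1))
    refine ⟨ModuleCat.of R R, fun ⟨s, hs, h⟩ ↦ hS ?_, le_antisymm (le_iSup
      (fun M : ModuleCat.{u} R ↦ sFlatDim S M) _) ?_⟩
    · have : s * 1 = 0 := h 1
      rwa [← this, mul_one]
    · rw [← hM, hzero]
      exact zero_le
  · exact ⟨M, hT, hM⟩

theorem IsQuotientByRegular.sWeakGlobalDim_add_one_le (h : IsQuotientByRegular a R')
    (hS : 0 ∉ S.map (algebraMap R R'))
    (hfin : sWeakGlobalDim R' (S.map (algebraMap R R')) < ⊤) :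
    sWeakGlobalDim R' (S.map (algebraMap R R')) + 1 ≤ sWeakGlobalDim R S := by
  obtain ⟨M, hM, hdim⟩ := exists_sFlatDim_eq_sWeakGlobalDim hS hfin
  let _ : Module R M := Module.compHom M (algebraMap R R')
  have : IsScalarTower R R' M := .of_algebraMap_smul fun _ _ ↦ rfl
  rw [isUniformlySTorsion_map_algebraMap_iff] at hM
  rw [← hdim] at hfin ⊢
  rw [← h.sFlatDim_eq_add_one hM hfin]
  exact le_iSup (fun N : ModuleCat.{u} R ↦ sFlatDim S N) (ModuleCat.of R M)

end FlatDimensionModRegular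

theorem mainTheorem7 {R : Type u} [CommRing R] (S : Submonoid R) (a : R)
    (ha : a ∈ nonZeroDivisors R) (hu : ¬ IsUnit a) :
    (∀ (M : Type u) [AddCommGroup M] [Module R M] [Module (R ⧸ Ideal.span {a}) M]
        [IsScalarTower R (R ⧸ Ideal.span {a}) M],
      ¬ IsUniformlySTorsion (S.map (Ideal.Quotient.mk (Ideal.span {a}))) M →
      sFlatDim (S.map (Ideal.Quotient.mk (Ideal.span {a}))) M < ⊤ →
      sFlatDim S M = sFlatDim (S.map (Ideal.Quotient.mk (Ideal.span {a}))) M + 1) ∧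
    (0 ∉ S.map (Ideal.Quotient.mk (Ideal.span {a})) →
      sWeakGlobalDim (R ⧸ Ideal.span {a}) (S.map (Ideal.Quotient.mk (Ideal.span {a}))) < ⊤ →
      sWeakGlobalDim R S ≥
        sWeakGlobalDim (R ⧸ Ideal.span {a}) (S.map (Ideal.Quotient.mk (Ideal.span {a}))) + 1) := by
  have h : IsQuotientByRegular a (R ⧸ Ideal.span {a}) := isQuotientByRegular_quotient ha
  refine ⟨fun M _ _ _ _ hM hfin ↦ ?_, h.sWeakGlobalDim_add_one_le⟩
  exact h.sFlatDim_eq_add_one (mt isUniformlySTorsion_map_algebraMap_iff.2 hM) hfin
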